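/- Let $d_0\ge 1$, let $p_1,\dots,p_{d_0}\ge 0$ with $\sum_d p_d=1$, and for each $1\le d\le d_0$ let $\zeta_{1,d},\dots,\zeta_{d,d}\ge 0$ with $\sum_{k=1}^d\zeta_{k,d}=1$. Let $q$ be a continuous, compactly supported probability density on $\mathbb R$. Consider a branching random walk started from one particle at $0$, in which every particle $v$ has a random number $d(v)$ of children with $\mathbb P[d(v)=d]=p_d$ for $1\le d\le d_0$, and every child is displaced from its parent by an increment with density $q$. Attach to every particle $v$ a random threshold $L_v\in\{1,\dots,d(v)\}$ with $\mathbb P[L_v=k\mid d(v)=d]=\zeta_{k,d}$. The pairs $(d(v),L_v)$ and the increments are all independent. For $n\ge 0$ assign to each particle of generation $n$ its position, and then, generation by generation towards the root, assign to each particle $v$ of generation less than $n$ the $L_v$-th smallest of the values assigned to its children. Let $M_n$ be the value assigned in this way to the root. Set $$g(x)=\sum_{d=1}^{d_0}\sum_{k=1}^d p_d\,\zeta_{k,d}\sum_{l=k}^d\binom dl x^l(1-x)^{d-l},\qquad f(u)=g(u)-u,$$ and assume $f\not\equiv 0$. Let $N_f$ be the number of zeros of $f$ in $(0,1)$ and let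 $0=\alpha_0<\alpha_1<\dots<\alpha_{N_f+1}=1$ be the zeros of $f$ in $[0,1]$. For $0\le s\le N_f+1$ and $n\ge 0$ let $q_{s,n}\in[-\infty,\infty]$ be any $\alpha_s$-quantile of $M_n$, that is, $\mathbb P[M_n<q_{s,n}]\le\alpha_s\le\mathbb P[M_n\le q_{s,n}]$, and let $I_{s,n}=\mathbb{R}\cap[q_{s-1,n},q_{s,n}]$ for $1\le s\le N_f+1$. Then for every $s\in\{1,\dots,N_f+1\}$ we have $\mathbb P[M_n\in I_{s,n}]>0$ for all $n$, and if $M_{n;I_{s,n}}$ denotes a random variable whose law is the conditional law of $M_n$ given $M_n\in I_{s,n}$, and $\mathrm{med}(M_{n;I_{s,n}})$ any median of it, then the sequence $\big(M_{n;I_{s,n}}-\mathrm{med}(M_{n;I_{s,n}})\big)_{n\ge 0}$ is tight. -/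

import Mathlib

open MeasureTheory ProbabilityTheory

noncomputable section

/-- The parameters `(p_d, ζ_{k,d})`, `1 ≤ k ≤ d ≤ d₀`, of a random threshold voting model:
an offspring law on `{1, …, d₀}` and, for every `d`, a law on the thresholds `{1, …, d}`.
Only the values at `1 ≤ k ≤ d ≤ d₀` matter; `ζ k d` stands for `ζ_{k,d}`. -/
structure ThresholdModel where
  d₀ : ℕ
  p : ℕ → ℝ
  ζ : ℕ → ℕ → ℝ
  p_nonneg : ∀ d ∈ Finset.Icc 1 d₀, 0 ≤ p d
  p_sum : ∑ d ∈ Finset.Icc 1 d₀, p d = 1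
  ζ_nonneg : ∀ d ∈ Finset.Icc 1 d₀, ∀ k ∈ Finset.Icc 1 d, 0 ≤ ζ k d
  ζ_sum : ∀ d ∈ Finset.Icc 1 d₀, ∑ k ∈ Finset.Icc 1 d, ζ k d = 1

namespace ThresholdModel

/-- The recursion polynomial `g`. -/
def recursionPoly (V : ThresholdModel) (x : ℝ) : ℝ :=
  ∑ d ∈ Finset.Icc 1 V.d₀, ∑ k ∈ Finset.Icc 1 d,
    V.p d * V.ζ k d * ∑ l ∈ Finset.Icc k d, (d.choose l : ℝ) * x ^ l * (1 - x) ^ (d - l)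

/-- The nonlinearity `f(u) = g(u) - u`. -/
def nonlinearity (V : ThresholdModel) (u : ℝ) : ℝ :=
  V.recursionPoly u - u

/-- `N_f`, the number of zeros of the nonlinearity in the open interval `(0, 1)`. -/
def numZeros (V : ThresholdModel) : ℕ :=
  Set.ncard {u : ℝ | u ∈ Set.Ioo (0 : ℝ) 1 ∧ V.nonlinearity u = 0}

end ThresholdModel

/-- A continuous, compactly supported probability density on the line. -/
structure IsJumpDensity (q : ℝ → ℝ) : Prop where
  continuous : Continuous q
  hasCompactSupport : HasCompactSupport q
  nonneg : ∀ x, 0 ≤ q x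
  integral_eq_one : ∫ x, q x = 1

/-- `orderStat k s` is `s_{(k)}`, the `k`-th element of `s` in increasing order, `1 ≤ k ≤ card s`
(other `k` do not occur in a vote, up to null events). -/
def orderStat (k : ℕ) (s : Multiset ℝ) : ℝ :=
  (s.sort (· ≤ ·)).getD (k - 1) 0

section Voting

variable {Ω : Type*}

/-- Position of the vertex `v` of a branching random walk started at `0`. Vertices are Ulam–Harris
labels: `[]` is the root, the children of `v` are `i :: v` with `i < d(v)`, and `X v` is the
displacement of `v` from its parent. -/
def brwPosition (X : List ℕ → Ω → ℝ) : List ℕ → Ω → ℝ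
  | [], _ => 0
  | i :: v, ω => brwPosition X v ω + X (i :: v) ω

/-- The value propagated to the vertex `v` when voting starts `h` generations below `v`: for `h = 0`
it is the position of `v`, otherwise it is the `L_v`-th smallest of the values at the
`d(v)` children of `v`. -/
def voteValue (d L : List ℕ → Ω → ℕ) (X : List ℕ → Ω → ℝ) : ℕ → List ℕ → Ω → ℝ
  | 0, v, ω => brwPosition X v ω
  | h + 1, v, ω =>
      orderStat (L v ω) ((Multiset.range (d v ω)).map fun i => voteValue d L X h (i :: v) ω)

/-- The outcome `M_n` of the vote: the value at the root when generation `n` votes first. -/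
def voteOutcome (d L : List ℕ → Ω → ℕ) (X : List ℕ → Ω → ℝ) (n : ℕ) (ω : Ω) : ℝ :=
  voteValue d L X n [] ω

/-- `d`, `L`, `X` are the offspring numbers, the thresholds and the displacements of a branching
random walk with offspring law `p_d`, jump density `q` and random threshold voting: over different
vertices everything is independent, at a vertex `X_v` is independent of `(d(v), L_v)`,
`P[d(v) = d, L_v = k] = p_d ζ_{k,d}`, and `X_v` has density `q`. -/
structure IsThresholdVoting [MeasurableSpace Ω] (P : Measure Ω) (V : ThresholdModel) (q : ℝ → ℝ)
    (d L : List ℕ → Ω → ℕ) (X : List ℕ → Ω → ℝ) : Prop where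
  measurable_d : ∀ v, Measurable (d v)
  measurable_L : ∀ v, Measurable (L v)
  measurable_X : ∀ v, Measurable (X v)
  indep_vertices : iIndepFun (fun v ω => ((d v ω, L v ω), X v ω)) P
  indep_displacement : ∀ v, IndepFun (fun ω => (d v ω, L v ω)) (X v) P
  law_threshold : ∀ v, ∀ e ∈ Finset.Icc 1 V.d₀, ∀ k ∈ Finset.Icc 1 e,
    P {ω | d v ω = e ∧ L v ω = k} = ENNReal.ofReal (V.p e * V.ζ k e)
  law_displacement : ∀ v, P.map (X v) = volume.withDensity fun x => ENNReal.ofReal (q x)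

end Voting

/-- `x` is an `α`-quantile of `μ`: `μ (-∞, x) ≤ α ≤ μ (-∞, x]`. Extended real values allow
`-∞` as a `0`-quantile and `+∞` as a `1`-quantile; for `0 < α < 1` quantiles of a probability
measure are real. -/
def IsQuantile (μ : Measure ℝ) (α : ℝ) (x : EReal) : Prop :=
  μ {y : ℝ | (y : EReal) < x} ≤ ENNReal.ofReal α ∧
    ENNReal.ofReal α ≤ μ {y : ℝ | (y : EReal) ≤ x}

/-- The real points of the closed interval with (possibly infinite) endpoints `a` and `b`. -/
def realIcc (a b : EReal) : Set ℝ :=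
  {y : ℝ | a ≤ (y : EReal) ∧ (y : EReal) ≤ b}

end

/-! Let `F n` be the distribution function of `M_n`, let `g` be the recursion polynomial, and let
`R` bound the displacements. At the root, `M_{n+1}` is the `L`-th smallest of independent terms `X_i
+ M_n^{(i)}`, so `F (n+1)` is squeezed between shifts by `R` of `g ∘ F n` (`recursionPoly_bounds`).
On the same tree, voting one generation later changes the outcome by at most `R`, so `F (n+1)` is
also squeezed between shifts of `F n` (`shift_bounds`). Eliminating `n+1` gives `F n (x - 2R) ≤ g (F
n x) ≤ F n (x + 2R)`, a relation for each single `n`.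

On a compact interval between two consecutive zeros, `g u - u` has constant sign and is bounded away
from zero. Each shift by `2R`, rightwards or leftwards according to the sign, therefore moves `F n`
by a fixed amount, and `F n` crosses the interval within a distance independent of `n`
(`exists_climb`). Only a small mass near the two quantiles escapes, which is tightness after
conditioning (`cond_realIcc_compl_Icc_le`). -/

/-! ### Order statistics through counting. -/

theorem List.getD_le_iff_le_countP {l : List ℝ} (hl : l.Pairwise (· ≤ ·)) (x : ℝ) {k : ℕ}
    (hk : k < l.length) : l.getD k 0 ≤ x ↔ k + 1 ≤ l.countP (· ≤ x) := by
  induction l generalizing k with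
  | nil => simp at hk
  | cons a t ih =>
    rw [List.pairwise_cons] at hl
    by_cases hax : a ≤ x
    · cases k with
      | zero => simp [hax]
      | succ k =>
        simp only [List.length_cons, Nat.add_lt_add_iff_right] at hk
        simp [hax, ← ih hl.2 hk]
    · have h0 : (a :: t).countP (· ≤ x) = 0 := by
        rw [List.countP_eq_zero]
        intro b hb
        rcases List.mem_cons.1 hb with rfl | hb
        · simpa using hax
        · have := hl.1 b hb
          simp only [decide_eq_true_eq]
          linarith [not_le.1 hax]
      rw [h0]
      simp only [Nat.le_zero, Nat.add_eq_zero_iff, one_ne_zero, and_false, iff_false, not_le]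
      cases k with
      | zero => simpa using hax
      | succ k =>
        simp only [List.length_cons, Nat.add_lt_add_iff_right] at hk
        have hmem : t[k] ∈ t := List.getElem_mem hk
        have := hl.1 _ hmem
        rw [List.getD_cons_succ, List.getD_eq_getElem _ _ hk]
        linarith [not_le.1 hax]

theorem orderStat_le_iff {k e : ℕ} (hk : 1 ≤ k) (hke : k ≤ e) (a : ℕ → ℝ) (x : ℝ) :
    orderStat k ((Multiset.range e).map a) ≤ x ↔
      k ≤ ((Finset.range e).filter fun i => a i ≤ x).card := by
  classical
  have hlen : k - 1 < (((Multiset.range e).map a).sort (· ≤ ·)).length := by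
    simp; omega
  rw [orderStat, List.getD_le_iff_le_countP (Multiset.pairwise_sort _ _) x hlen,
    Nat.sub_add_cancel hk]
  have : (((Multiset.range e).map a).sort (· ≤ ·)).countP (· ≤ x)
      = ((Finset.range e).filter fun i => a i ≤ x).card := by
    rw [← Multiset.coe_countP, Multiset.sort_eq, Multiset.countP_map]
    rfl
  rw [this]

theorem exists_orderStat_eq {k e : ℕ} (hk : 1 ≤ k) (hke : k ≤ e) (a : ℕ → ℝ) :
    ∃ i, orderStat k ((Multiset.range e).map a) = a i := by
  have hlen : k - 1 < (((Multiset.range e).map a).sort (· ≤ ·)).length := by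
    simp; omega
  have hmem : orderStat k ((Multiset.range e).map a) ∈ (Multiset.range e).map a := by
    rw [orderStat, List.getD_eq_getElem _ _ hlen, ← Multiset.mem_sort (· ≤ ·)]
    exact List.getElem_mem hlen
  obtain ⟨i, -, hi⟩ := Multiset.mem_map.1 hmem
  exact ⟨i, hi.symm⟩

/-- Every index counted for `b` at its own order statistic is counted for `a` at that level plus
`c`. Applied both ways, this makes order statistics 1-Lipschitz in the sup norm. -/
theorem orderStat_le_add {k e : ℕ} (hk : 1 ≤ k) (hke : k ≤ e) {a b : ℕ → ℝ} {c : ℝ}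
    (h : ∀ i, a i ≤ b i + c) :
    orderStat k ((Multiset.range e).map a) ≤ orderStat k ((Multiset.range e).map b) + c := by
  rw [orderStat_le_iff hk hke]
  refine ((orderStat_le_iff hk hke b _).1 le_rfl).trans (Finset.card_le_card ?_)
  intro i hi
  simp only [Finset.mem_filter] at hi ⊢
  exact ⟨hi.1, by linarith [h i, hi.2]⟩

theorem orderStat_const_add {k e : ℕ} (hk : 1 ≤ k) (hke : k ≤ e) (a : ℕ → ℝ) (c : ℝ) :
    orderStat k ((Multiset.range e).map fun i => c + a i)
      = c + orderStat k ((Multiset.range e).map a) := by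
  apply le_antisymm
  · rw [add_comm c]
    exact orderStat_le_add hk hke fun i => by linarith
  · have := orderStat_le_add (c := -c) (a := a) (b := fun i => c + a i) hk hke
      fun i => by linarith
    linarith

theorem orderStat_eq_zero {k e : ℕ} (h : e < k ∨ e = 0) (a : ℕ → ℝ) :
    orderStat k ((Multiset.range e).map a) = 0 := by
  rw [orderStat, List.getD_eq_default]
  simp; omega

/-! ### Measurability of the vote. -/

section

variable {Ω : Type*} [MeasurableSpace Ω]

theorem measurableSet_le_card_filter (k e : ℕ) {Y : ℕ → Ω → ℝ} (hY : ∀ i, Measurable (Y i))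
    (x : ℝ) : MeasurableSet {ω | k ≤ ((Finset.range e).filter fun i => Y i ω ≤ x).card} := by
  have : Measurable fun ω => ((Finset.range e).filter fun i => Y i ω ≤ x).card := by
    simp only [Finset.card_filter]
    refine Finset.measurable_sum _ fun i _ => ?_
    exact Measurable.ite (measurableSet_le (hY i) measurable_const) measurable_const
      measurable_const
  exact measurableSet_le measurable_const this

theorem measurable_orderStat_range (k e : ℕ) {Y : ℕ → Ω → ℝ} (hY : ∀ i, Measurable (Y i)) :
    Measurable fun ω => orderStat k ((Multiset.range e).map fun i => Y i ω) := by
  have key : ∀ k, 1 ≤ k →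
      Measurable fun ω => orderStat k ((Multiset.range e).map fun i => Y i ω) := by
    intro k hk
    by_cases hke : k ≤ e
    · refine measurable_of_Iic fun x => ?_
      have : (fun ω => orderStat k ((Multiset.range e).map fun i => Y i ω)) ⁻¹' Set.Iic x
          = {ω | k ≤ ((Finset.range e).filter fun i => Y i ω ≤ x).card} := by
        ext ω
        exact orderStat_le_iff hk hke _ x
      rw [this]
      exact measurableSet_le_card_filter k e hY x
    · simp only [orderStat_eq_zero (Or.inl (not_le.1 hke))]
      exact measurable_const
  -- Truncated subtraction makes rank `0` read the same list entry as rank `1`.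
  rcases Nat.eq_zero_or_pos k with rfl | hk
  · exact key 1 le_rfl
  · exact key k hk

theorem measurable_orderStat {d L : Ω → ℕ} (hd : Measurable d) (hL : Measurable L)
    {Y : ℕ → Ω → ℝ} (hY : ∀ i, Measurable (Y i)) :
    Measurable fun ω => orderStat (L ω) ((Multiset.range (d ω)).map fun i => Y i ω) := by
  have h : Measurable fun p : (ℕ × ℕ) × Ω =>
      orderStat p.1.2 ((Multiset.range p.1.1).map fun i => Y i p.2) :=
    measurable_from_prod_countable_right fun p => measurable_orderStat_range p.2 p.1 hY
  exact h.comp ((hd.prodMk hL).prodMk measurable_id)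

/-- Measurability is asked only of labels no longer than `v`, so that the lemma also applies to the
σ-algebra generated by those displacements alone. -/
theorem measurable_brwPosition {X : List ℕ → Ω → ℝ} (v : List ℕ)
    (hX : ∀ w, w.length ≤ v.length → Measurable (X w)) : Measurable (brwPosition X v) := by
  induction v with
  | nil => exact measurable_const
  | cons i v ih =>
    exact (ih fun w hw => hX w (hw.trans (by simp))).add (hX _ le_rfl)

theorem measurable_voteValue {d L : List ℕ → Ω → ℕ} {X : List ℕ → Ω → ℝ}
    (hd : ∀ v, Measurable (d v)) (hL : ∀ v, Measurable (L v)) (hX : ∀ v, Measurable (X v))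
    (h : ℕ) (v : List ℕ) : Measurable (voteValue d L X h v) := by
  induction h generalizing v with
  | zero => exact measurable_brwPosition v fun w _ => hX w
  | succ h ih => exact measurable_orderStat (hd v) (hL v) fun i => ih (i :: v)

end

/-! ### Pathwise comparison and decomposition into subtrees. -/

section Pathwise

variable {Ω : Type*} {d L : List ℕ → Ω → ℕ} {X : List ℕ → Ω → ℝ} {ω : Ω}

/-- Where voting starts, the value of a vertex is replaced by the position of one of its children,
one displacement away; the Lipschitz property of order statistics carries this error to the root
without amplifying it. -/
theorem abs_voteValue_succ_sub_le {R : ℝ} (hL : ∀ v, 1 ≤ L v ω) (hLd : ∀ v, L v ω ≤ d v ω)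
    (hX : ∀ v, |X v ω| ≤ R) (h : ℕ) (v : List ℕ) :
    |voteValue d L X (h + 1) v ω - voteValue d L X h v ω| ≤ R := by
  induction h generalizing v with
  | zero =>
    obtain ⟨i, hi⟩ := exists_orderStat_eq (hL v) (hLd v) fun i => voteValue d L X 0 (i :: v) ω
    rw [show voteValue d L X (0 + 1) v ω = voteValue d L X 0 (i :: v) ω from hi]
    simpa [voteValue, brwPosition] using hX (i :: v)
  | succ h ih =>
    rw [abs_sub_le_iff, voteValue, voteValue]
    constructor <;> rw [sub_le_iff_le_add'] <;> refine orderStat_le_add (hL v) (hLd v) fun i => ?_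
    · have := (abs_sub_le_iff.1 (ih (i :: v))).1
      linarith
    · have := (abs_sub_le_iff.1 (ih (i :: v))).2
      linarith

theorem exists_voteValue_eq_brwPosition (hL : ∀ v, 1 ≤ L v ω) (hLd : ∀ v, L v ω ≤ d v ω)
    (h : ℕ) (v : List ℕ) : ∃ u : List ℕ, u.length = h ∧
      voteValue d L X h v ω = brwPosition X (u ++ v) ω := by
  induction h generalizing v with
  | zero => exact ⟨[], rfl, rfl⟩
  | succ h ih =>
    obtain ⟨i, hi⟩ := exists_orderStat_eq (hL v) (hLd v) fun i => voteValue d L X h (i :: v) ω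
    obtain ⟨u, hu, huv⟩ := ih (i :: v)
    exact ⟨u ++ [i], by simp [hu], by rw [voteValue, hi, huv]; simp⟩

/-- The marks of a vertex: offspring number, threshold, displacement. -/
abbrev Mark : Type := (ℕ × ℕ) × ℝ

/-- The outcome of the vote as a function of the marks of all vertices. -/
noncomputable def markOutcome (n : ℕ) (z : List ℕ → Mark) : ℝ :=
  voteOutcome (fun v z => (z v).1.1) (fun v z => (z v).1.2)
    (fun v (z : List ℕ → Mark) => (z v).2) n z

/-- The marks of the subtree rooted at `v`. -/
def subtreeMarks (d L : List ℕ → Ω → ℕ) (X : List ℕ → Ω → ℝ) (v : List ℕ) (ω : Ω) :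
    List ℕ → Mark :=
  fun w => ((d (w ++ v) ω, L (w ++ v) ω), X (w ++ v) ω)

theorem brwPosition_append (u v : List ℕ) :
    brwPosition X (u ++ v) ω = brwPosition X v ω +
      brwPosition (fun w (z : List ℕ → Mark) => (z w).2) u (subtreeMarks d L X v ω) := by
  induction u with
  | nil => simp [brwPosition]
  | cons i u ih =>
    rw [List.cons_append, brwPosition, ih, brwPosition, add_assoc]
    rfl

/-- All positions below `v` contain the position of `v` as a common summand, and order statistics
commute with translations. -/
theorem voteValue_append (hL : ∀ v, 1 ≤ L v ω) (hLd : ∀ v, L v ω ≤ d v ω) (h : ℕ)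
    (u v : List ℕ) :
    voteValue d L X h (u ++ v) ω = brwPosition X v ω +
      voteValue (fun v z => (z v).1.1) (fun v z => (z v).1.2)
        (fun v (z : List ℕ → Mark) => (z v).2) h u (subtreeMarks d L X v ω) := by
  induction h generalizing u with
  | zero => exact brwPosition_append u v
  | succ h ih =>
    rw [voteValue, voteValue]
    simp only [← List.cons_append, ih]
    exact orderStat_const_add (hL (u ++ v)) (hLd (u ++ v)) _ _

theorem voteValue_eq_add_markOutcome (hL : ∀ v, 1 ≤ L v ω) (hLd : ∀ v, L v ω ≤ d v ω) (h : ℕ)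
    (v : List ℕ) :
    voteValue d L X h v ω = brwPosition X v ω + markOutcome h (subtreeMarks d L X v ω) :=
  voteValue_append hL hLd h [] v

theorem measurable_markOutcome (n : ℕ) : Measurable (markOutcome n) :=
  measurable_voteValue (fun v => by fun_prop) (fun v => by fun_prop) (fun v => by fun_prop) n []

end Pathwise

/-! ### Conditioning between two quantiles. -/

section Quantiles

theorem measurableSet_realIcc (a b : EReal) : MeasurableSet (realIcc a b) :=
  (measurableSet_le measurable_const measurable_coe_real_ereal).inter
    (measurableSet_le measurable_coe_real_ereal measurable_const)

variable {μ : Measure ℝ} {α β : ℝ} {a b : EReal}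

theorem measure_coe_le_le_coe_lt [NullSingletonClass μ] (a : EReal) :
    μ {y : ℝ | (y : EReal) ≤ a} ≤ μ {y : ℝ | (y : EReal) < a} := by
  have hsub : ({y : ℝ | (y : EReal) = a}).Subsingleton := fun x hx y hy =>
    EReal.coe_injective (hx.trans hy.symm)
  calc μ {y : ℝ | (y : EReal) ≤ a}
      ≤ μ ({y : ℝ | (y : EReal) < a} ∪ {y : ℝ | (y : EReal) = a}) :=
        measure_mono fun y (hy : (y : EReal) ≤ a) => hy.lt_or_eq
    _ ≤ μ {y : ℝ | (y : EReal) < a} + μ {y : ℝ | (y : EReal) = a} := measure_union_le _ _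
    _ = μ {y : ℝ | (y : EReal) < a} := by rw [hsub.measure_zero, add_zero]

/-- Atoms are allowed here, so the bound also covers the deterministic outcome at `n = 0`. -/
theorem IsQuantile.sub_le_real_realIcc [IsProbabilityMeasure μ] (hα : 0 ≤ α)
    (ha : IsQuantile μ α a) (hb : IsQuantile μ β b) : β - α ≤ μ.real (realIcc a b) := by
  have h1 : β ≤ μ.real {y : ℝ | (y : EReal) ≤ b} :=
    (ENNReal.ofReal_le_iff_le_toReal (measure_ne_top _ _)).1 hb.2
  have h2 : μ.real {y : ℝ | (y : EReal) < a} ≤ α := ENNReal.toReal_le_of_le_ofReal hα ha.1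
  have h3 : μ.real {y : ℝ | (y : EReal) ≤ b}
      ≤ μ.real {y : ℝ | (y : EReal) < a} + μ.real (realIcc a b) := by
    refine (measureReal_mono fun y hy => ?_).trans (measureReal_union_le _ _)
    rcases lt_or_ge (y : EReal) a with h | h
    · exact Or.inl h
    · exact Or.inr ⟨h, hy⟩
  linarith

/-- Without atoms, mass at least `α` lies strictly below `a`; when `a ≤ t` this leaves at most `η`
for the rest of `Iic t`. -/
theorem IsQuantile.real_Iic_inter_realIcc_le [IsProbabilityMeasure μ] [NullSingletonClass μ]
    (ha : IsQuantile μ α a) (b : EReal) {t η : ℝ} (hη : 0 ≤ η)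
    (ht : μ.real (Set.Iic t) ≤ α + η) : μ.real (realIcc a b ∩ Set.Iic t) ≤ η := by
  rcases lt_or_ge (t : EReal) a with hta | hta
  · have : realIcc a b ∩ Set.Iic t = ∅ := by
      refine Set.eq_empty_of_forall_notMem fun y hy => ?_
      have h1 : (y : EReal) ≤ t := EReal.coe_le_coe_iff.2 hy.2
      exact absurd (hy.1.1.trans h1) (not_le.2 hta)
    simpa [this] using hη
  · have h1 : α ≤ μ.real {y : ℝ | (y : EReal) < a} :=
      (ENNReal.ofReal_le_iff_le_toReal (measure_ne_top _ _)).1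
        (ha.2.trans (measure_coe_le_le_coe_lt a))
    have h2 : μ.real (realIcc a b ∩ Set.Iic t) + μ.real {y : ℝ | (y : EReal) < a}
        ≤ μ.real (Set.Iic t) := by
      have hdisj : Disjoint (realIcc a b ∩ Set.Iic t) {y : ℝ | (y : EReal) < a} :=
        Set.disjoint_left.2 fun y hy hy' => absurd hy.1.1 (not_le.2 hy')
      have hmeas : MeasurableSet {y : ℝ | (y : EReal) < a} :=
        measurableSet_lt measurable_coe_real_ereal measurable_const
      rw [← measureReal_union hdisj hmeas]
      refine measureReal_mono (Set.union_subset Set.inter_subset_right fun y hy => ?_)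
      exact EReal.coe_le_coe_iff.1 ((le_of_lt hy).trans hta)
    linarith

theorem IsQuantile.real_Ioi_inter_realIcc_le [IsProbabilityMeasure μ] [NullSingletonClass μ]
    (hβ : 0 ≤ β) (hb : IsQuantile μ β b) (a : EReal) {t η : ℝ} (hη : 0 ≤ η)
    (ht : β - η ≤ μ.real (Set.Iic t)) : μ.real (realIcc a b ∩ Set.Ioi t) ≤ η := by
  rcases lt_or_ge b (t : EReal) with hbt | hbt
  · have : realIcc a b ∩ Set.Ioi t = ∅ := by
      refine Set.eq_empty_of_forall_notMem fun y hy => ?_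
      have h1 : (t : EReal) ≤ y := EReal.coe_le_coe_iff.2 (le_of_lt hy.2)
      exact absurd (h1.trans hy.1.2) (not_le.2 hbt)
    simpa [this] using hη
  · have h1 : μ.real {y : ℝ | (y : EReal) ≤ b} ≤ β :=
      ENNReal.toReal_le_of_le_ofReal hβ ((measure_coe_le_le_coe_lt b).trans hb.1)
    have h2 : μ.real (Set.Iic t) + μ.real (realIcc a b ∩ Set.Ioi t)
        ≤ μ.real {y : ℝ | (y : EReal) ≤ b} := by
      have hdisj : Disjoint (Set.Iic t) (realIcc a b ∩ Set.Ioi t) :=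
        Set.disjoint_left.2 fun y (hy : y ≤ t) hy' => absurd hy (not_le.2 hy'.2)
      rw [← measureReal_union hdisj ((measurableSet_realIcc a b).inter measurableSet_Ioi)]
      refine measureReal_mono (Set.union_subset (fun y hy => ?_) fun y hy => hy.1.2)
      exact (EReal.coe_le_coe_iff.2 hy).trans hbt
    linarith

/-- If the distribution function of `μ` climbs from above `α + η` to `β - η` within distance `K`,
then the law `μ` conditioned between an `α`- and a `β`-quantile concentrates around its medians. -/
theorem cond_realIcc_compl_Icc_le [IsProbabilityMeasure μ] [NullSingletonClass μ] (hα : 0 ≤ α)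
    (hαβ : α < β) (ha : IsQuantile μ α a) (hb : IsQuantile μ β b) {η K : ℝ} (hη : 0 ≤ η)
    (hηδ : 2 * η < β - α)
    (hK : ∀ x, α + η < μ.real (Set.Iic x) → β - η ≤ μ.real (Set.Iic (x + K)))
    {m : ℝ} (hm : IsQuantile (μ[|realIcc a b]) (1 / 2) (m : EReal)) {K' : ℝ} (hK' : K < K') :
    (μ[|realIcc a b]).real (Set.Icc (m - K') (m + K'))ᶜ ≤ 2 * η / (β - α) := by
  set I := realIcc a b with hI
  have hIm : MeasurableSet I := measurableSet_realIcc a b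
  have hδ : 0 < β - α := sub_pos.2 hαβ
  have hμI : β - α ≤ μ.real I := ha.sub_le_real_realIcc hα hb
  have hcond : ∀ s, (μ[|I]).real s = μ.real (I ∩ s) / μ.real I := fun s => by
    rw [measureReal_def, cond_apply hIm, ENNReal.toReal_mul, ENNReal.toReal_inv, div_eq_inv_mul]
    rfl
  have hprob : IsProbabilityMeasure (μ[|I]) := by
    refine cond_isProbabilityMeasure fun h0 => ?_
    have : μ.real I = 0 := by simp [measureReal_def, h0]
    linarith
  have hm1 : (μ[|I]).real (Set.Iio m) ≤ 1 / 2 := by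
    have := ENNReal.toReal_le_of_le_ofReal (by norm_num) hm.1
    simp only [EReal.coe_lt_coe_iff] at this
    exact this
  have hm2 : 1 / 2 ≤ (μ[|I]).real (Set.Iic m) := by
    have := (ENNReal.ofReal_le_iff_le_toReal (measure_ne_top _ _)).1 hm.2
    simp only [EReal.coe_le_coe_iff] at this
    exact this
  have hm3 : 1 / 2 ≤ (μ[|I]).real (Set.Ici m) := by
    have := probReal_compl_eq_one_sub (μ := μ[|I]) (measurableSet_Iio (a := m))
    rw [Set.compl_Iio] at this
    linarith
  rw [hcond, le_div_iff₀ (by linarith)] at hm2 hm3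
  -- Otherwise the climb from `m - K'` ends at `m - K' + K < m`, leaving mass at most `η` of `I` on
  -- `[m, ∞)`. The median puts at least half of `μ I` there, which exceeds `η`.
  have hleft : μ.real (I ∩ Set.Iic (m - K')) ≤ η := by
    refine ha.real_Iic_inter_realIcc_le b hη (not_lt.1 fun hlt => ?_)
    have h1 := hb.real_Ioi_inter_realIcc_le (hα.trans hαβ.le) a hη (hK _ hlt)
    have h2 : μ.real (I ∩ Set.Ici m) ≤ μ.real (I ∩ Set.Ioi (m - K' + K)) :=
      measureReal_mono (Set.inter_subset_inter_right _ fun y (hy : m ≤ y) => by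
        simp only [Set.mem_Ioi]; linarith)
    linarith
  have hright : μ.real (I ∩ Set.Ioi (m + K')) ≤ η := by
    refine hb.real_Ioi_inter_realIcc_le (hα.trans hαβ.le) a hη (not_lt.1 fun hlt => ?_)
    have h0 : μ.real (Set.Iic (m + K' - K)) ≤ α + η := not_lt.1 fun h => by
      have := hK _ h
      rw [sub_add_cancel] at this
      linarith
    have h1 := ha.real_Iic_inter_realIcc_le b hη h0
    have h2 : μ.real (I ∩ Set.Iic m) ≤ μ.real (I ∩ Set.Iic (m + K' - K)) :=
      measureReal_mono (Set.inter_subset_inter_right _ fun y (hy : y ≤ m) => by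
        simp only [Set.mem_Iic]; linarith)
    linarith
  have hcompl : μ.real (I ∩ (Set.Icc (m - K') (m + K'))ᶜ) ≤ 2 * η := by
    have hsub : I ∩ (Set.Icc (m - K') (m + K'))ᶜ
        ⊆ (I ∩ Set.Iic (m - K')) ∪ (I ∩ Set.Ioi (m + K')) := by
      rintro y ⟨hyI, hy⟩
      rw [Set.mem_compl_iff, Set.mem_Icc, not_and_or, not_le, not_le] at hy
      exact hy.imp (fun h => ⟨hyI, h.le⟩) fun h => ⟨hyI, h⟩
    have := (measureReal_mono (μ := μ) hsub).trans (measureReal_union_le _ _)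
    linarith
  rw [hcond]
  exact div_le_div₀ (by linarith) hcompl hδ hμI

end Quantiles

/-! ### Crossing an interval without fixed points. -/

section Climb

theorem le_min_of_iterate {F : ℝ → ℝ} (hF : Monotone F) {g : ℝ → ℝ} {a b c r : ℝ} (hr : 0 ≤ r)
    (hg : ∀ u ∈ Set.Icc a b, u + c ≤ g u) (hFg : ∀ x, g (F x) ≤ F (x + r)) (hc : 0 ≤ c)
    {x : ℝ} (hx : a ≤ F x) (k : ℕ) : min b (a + k * c) ≤ F (x + k * r) := by
  induction k with
  | zero => simpa using Or.inr hx
  | succ k ih =>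
    have hstep : x + (k + 1 : ℕ) * r = x + k * r + r := by push_cast; ring
    rw [hstep]
    have hmono : F (x + k * r) ≤ F (x + k * r + r) := hF (by linarith)
    rcases le_or_gt b (F (x + k * r)) with h | h
    · exact (min_le_left _ _).trans (h.trans hmono)
    · have h1 : a + k * c ≤ F (x + k * r) := by
        rcases min_le_iff.1 ih with h' | h'
        · linarith
        · exact h'
      have h2 : a ≤ F (x + k * r) := by
        have : 0 ≤ (k : ℝ) * c := by positivity
        linarith
      have h3 := hg _ ⟨h2, h.le⟩
      refine (min_le_right _ _).trans ?_
      have := hFg (x + k * r)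
      push_cast
      linarith

/-- The reflection `F ↦ -F(-·)`, `g ↦ -g(-·)` exchanges climbing to the right with descending to the
left. -/
theorem max_le_of_iterate {F : ℝ → ℝ} (hF : Monotone F) {g : ℝ → ℝ} {a b c r : ℝ} (hr : 0 ≤ r)
    (hg : ∀ u ∈ Set.Icc a b, g u ≤ u - c) (hFg : ∀ x, F (x - r) ≤ g (F x)) (hc : 0 ≤ c)
    {x : ℝ} (hx : F x ≤ b) (k : ℕ) : F (x - k * r) ≤ max a (b - k * c) := by
  have hF' : Monotone fun y => -F (-y) := fun y z hyz => neg_le_neg (hF (neg_le_neg hyz))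
  have := le_min_of_iterate (F := fun y => -F (-y)) hF' (g := fun u => -g (-u)) (a := -b) (b := -a)
    (c := c) hr (fun u hu => ?_) (fun y => ?_) hc (x := -x) (by simpa using hx) k
  · have hxk : -(-x + k * r) = x - k * r := by ring
    have hm : min (-a) (-b + k * c) = -max a (b - k * c) := by
      rw [← min_neg_neg]; congr 1; ring
    rw [hm, hxk] at this
    linarith
  · have := hg (-u) ⟨by linarith [hu.2], by linarith [hu.1]⟩
    linarith
  · have := hFg (-y)
    have hy : -(y + r) = -y - r := by ring
    simp only [neg_neg, hy]
    linarith

/-- A distribution function which dominates its own image under `g` after a shift by `r`, in both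
directions, crosses every compact interval free of fixed points of `g` within a distance that
depends only on `g`, `r` and the interval. -/
theorem exists_climb_of_fixedPointFree {g : ℝ → ℝ} (hgc : Continuous g) {a b r : ℝ} (hab : a ≤ b)
    (hr : 0 ≤ r) (hg : ∀ u ∈ Set.Icc a b, g u - u ≠ 0) :
    ∃ K, 0 ≤ K ∧ ∀ F : ℝ → ℝ, Monotone F → (∀ x, g (F x) ≤ F (x + r)) →
      (∀ x, F (x - r) ≤ g (F x)) → ∀ x, a < F x → b ≤ F (x + K) := by
  have hfc : ContinuousOn (fun u => g u - u) (Set.Icc a b) := by fun_prop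
  have hsign : (∀ u ∈ Set.Icc a b, 0 < g u - u) ∨ (∀ u ∈ Set.Icc a b, g u - u < 0) := by
    by_contra! h
    obtain ⟨⟨u, hu, hu'⟩, ⟨v, hv, hv'⟩⟩ := h
    obtain ⟨w, hw, hw'⟩ := isPreconnected_Icc.intermediate_value hu hv hfc ⟨hu', hv'⟩
    exact hg w hw hw'
  have hne : (Set.Icc a b).Nonempty := Set.nonempty_Icc.2 hab
  rcases hsign with h | h
  · obtain ⟨u, hu, hmin⟩ := isCompact_Icc.exists_isMinOn hne hfc
    set c := g u - u with hc
    have hc0 : 0 < c := h u hu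
    obtain ⟨k, hk⟩ := exists_nat_gt ((b - a) / c)
    rw [div_lt_iff₀ hc0] at hk
    refine ⟨k * r, by positivity, fun F hF hFg _ x hx => ?_⟩
    have := le_min_of_iterate hF hr (g := g) (a := a) (b := b) (c := c)
      (fun v hv => by have : c ≤ g v - v := hmin hv; linarith) hFg hc0.le hx.le k
    rwa [min_eq_left (by linarith)] at this
  · obtain ⟨u, hu, hmax⟩ := isCompact_Icc.exists_isMaxOn hne hfc
    set c := -(g u - u) with hc
    have hc0 : 0 < c := neg_pos.2 (h u hu)
    obtain ⟨k, hk⟩ := exists_nat_gt ((b - a) / c)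
    rw [div_lt_iff₀ hc0] at hk
    -- For negative sign the iteration runs leftwards from `x + K`: a value below `b` there would
    -- force `F x ≤ a`.
    refine ⟨k * r, by positivity, fun F hF _ hFg x hx => not_lt.1 fun hlt => ?_⟩
    have := max_le_of_iterate hF hr (g := g) (a := a) (b := b) (c := c)
      (fun v hv => by have : g v - v ≤ g u - u := hmax hv; linarith) hFg hc0.le hlt.le k
    rw [max_eq_left (by linarith), add_sub_cancel_right] at this
    linarith

end Climb

/-! ### Grouping independent variables. -/

section Fibers

variable {Ω ι J E : Type*} [MeasurableSpace Ω] [MeasurableSpace E] {P : Measure Ω}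

/-- Independent random variables grouped along the fibers of a map form independent families. -/
theorem ProbabilityTheory.iIndepFun.fibers {Z : ι → Ω → E} (hZ : ∀ i, Measurable (Z i))
    (h : iIndepFun Z P) (φ : ι → J) :
    iIndepFun (fun (j : J) (ω : Ω) (i : {i // φ i = j}) => Z i ω) P := by
  have := h.isProbabilityMeasure
  have hp : ∀ i, IsProbabilityMeasure (P.map (Z i)) :=
    fun i => Measure.isProbabilityMeasure_map (hZ i).aemeasurable
  -- The index set is rewritten as the disjoint union of the fibers; currying then turns the product
  -- law into a product over `J` of the laws on the fibers.
  have hσ : iIndepFun (fun (p : (j : J) × {i // φ i = j}) ω => Z p.2.1 ω) P := by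
    refine h.precomp (g := fun p : (j : J) × {i // φ i = j} => p.2.1) ?_
    rintro ⟨j, i, rfl⟩ ⟨j', i', rfl⟩ (rfl : i = i')
    rfl
  have hfib : ∀ j, iIndepFun (fun (i : {i // φ i = j}) ω => Z i ω) P := fun j =>
    h.precomp Subtype.val_injective
  have hmeas : ∀ j, Measurable fun ω (i : {i // φ i = j}) => Z i ω :=
    fun j => measurable_pi_iff.2 fun i => hZ i
  rw [iIndepFun_iff_map_fun_eq_infinitePi_map hmeas]
  have hcurry : (fun ω (j : J) (i : {i // φ i = j}) => Z i ω)
      = (MeasurableEquiv.piCurry fun (j : J) (_ : {i // φ i = j}) => E) ∘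
        fun ω (p : (j : J) × {i // φ i = j}) => Z p.2.1 ω := by
    ext; simp [Sigma.curry]
  have hσmeas : Measurable fun ω (p : (j : J) × {i // φ i = j}) => Z p.2.1 ω :=
    measurable_pi_iff.2 fun p => hZ p.2.1
  have hσmap : P.map (fun ω (p : (j : J) × {i // φ i = j}) => Z p.2.1 ω)
      = Measure.infinitePi fun p : (j : J) × {i // φ i = j} => P.map (Z p.2.1) :=
    hσ.map_fun_eq_infinitePi_map fun p => hZ p.2.1
  rw [hcurry, ← Measure.map_map (MeasurableEquiv.measurable _) hσmeas,
    hσmap,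
    Measure.infinitePi_map_piCurry (fun (j : J) (i : {i // φ i = j}) => P.map (Z i))]
  congrm Measure.infinitePi fun j => ?_
  have hj : P.map (fun ω (i : {i // φ i = j}) => Z i ω)
      = Measure.infinitePi fun i : {i // φ i = j} => P.map (Z i) :=
    iIndepFun.map_fun_eq_infinitePi_map (X := fun (i : {i // φ i = j}) ω => Z i ω)
      (fun i => hZ i) (hfib j)
  exact hj.symm

end Fibers

/-! ### Binomial tails. -/

section Binomial

variable {Ω : Type*} [MeasurableSpace Ω] {P : Measure Ω} [IsProbabilityMeasure P]

/-- The binomial tail: if `D, Y₀, Y₁, …` are independent and `P[Yᵢ ≤ y] = u` for all `i`, this is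
the probability that `D ∈ B` and at least `k` of `Y₀, …, Yₑ₋₁` are at most `y`. -/
theorem measureReal_inter_le_card_filter {β : Option ℕ → Type*} [∀ o, MeasurableSpace (β o)]
    {D : (o : Option ℕ) → Ω → β o} (hD : ∀ o, Measurable (D o)) (hind : iIndepFun D P)
    {S : (o : Option ℕ) → Set (β o)} (hS : ∀ o, MeasurableSet (S o)) {u : ℝ}
    (hu : ∀ i, P.real (D (some i) ⁻¹' S (some i)) = u)
    [hdec : ∀ i ω, Decidable (D (some i) ω ∈ S (some i))] (k e : ℕ) :
    P.real (D none ⁻¹' S none ∩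
        {ω | k ≤ ((Finset.range e).filter fun i => D (some i) ω ∈ S (some i)).card})
      = P.real (D none ⁻¹' S none) *
        ∑ l ∈ Finset.Icc k e, (e.choose l : ℝ) * u ^ l * (1 - u) ^ (e - l) := by
  classical
  -- The event is split according to the exact set `s` of successful indices. Each piece is an
  -- intersection of independent events whose probability depends on `s` only through its
  -- cardinality.
  set C : Finset ℕ → Set Ω := fun s =>
    D none ⁻¹' S none ∩ {ω | ((Finset.range e).filter fun i => D (some i) ω ∈ S (some i)) = s}
    with hC
  have hCeq : ∀ s ∈ (Finset.range e).powerset, C s = ⋂ o ∈ Finset.insertNone (Finset.range e),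
      D o ⁻¹' (Option.rec (motive := fun o => Set (β o)) (S none)
        (fun i => if i ∈ s then S (some i) else (S (some i))ᶜ) o) := by
    intro s hs
    rw [Finset.mem_powerset] at hs
    ext ω
    simp only [hC, Set.mem_inter_iff, Set.mem_preimage, Set.mem_ofPred_eq, Set.mem_iInter,
      Finset.forall_mem_insertNone]
    refine and_congr_right fun _ => ?_
    rw [Finset.ext_iff]
    constructor
    · intro h i hi
      by_cases his : i ∈ s
      · simpa [his] using ((Finset.mem_filter.1 ((h i).2 his)).2)
      · simp only [his, if_false, Set.mem_compl_iff]
        exact fun hmem => his ((h i).1 (Finset.mem_filter.2 ⟨hi, hmem⟩))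
    · intro h i
      rw [Finset.mem_filter]
      constructor
      · rintro ⟨hi, hmem⟩
        by_contra his
        have := h i hi
        simp only [his, if_false, Set.mem_compl_iff] at this
        exact this hmem
      · intro his
        have := h i (hs his)
        simp only [his, if_true] at this
        exact ⟨hs his, this⟩
  have hsets : ∀ (s : Finset ℕ) (o : Option ℕ), MeasurableSet
      (Option.rec (motive := fun o => Set (β o)) (S none)
        (fun i => if i ∈ s then S (some i) else (S (some i))ᶜ) o) := by
    intro s o
    cases o with
    | none => exact hS none
    | some i =>
      change MeasurableSet (if i ∈ s then S (some i) else (S (some i))ᶜ)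
      split_ifs
      · exact hS _
      · exact (hS _).compl
  have hCmeas : ∀ s ∈ (Finset.range e).powerset, MeasurableSet (C s) := fun s hs => by
    rw [hCeq s hs]
    exact Finset.measurableSet_biInter _ fun o _ => hD o (hsets s o)
  have hCval : ∀ s ∈ (Finset.range e).powerset,
      P.real (C s) = P.real (D none ⁻¹' S none) * (u ^ s.card * (1 - u) ^ (e - s.card)) := by
    intro s hs
    rw [hCeq s hs, measureReal_def, hind.meas_biInter fun o _ => ⟨_, hsets s o, rfl⟩,
      ENNReal.toReal_prod, Finset.prod_insertNone]
    refine congrArg₂ _ rfl ?_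
    have hprod : ∀ i, (P (D (some i) ⁻¹' (if i ∈ s then S (some i) else (S (some i))ᶜ))).toReal
        = if i ∈ s then u else 1 - u := by
      intro i
      split_ifs
      · exact hu i
      · rw [Set.preimage_compl, ← measureReal_def,
          probReal_compl_eq_one_sub (hD _ (hS _)), hu i]
    rw [Finset.mem_powerset] at hs
    calc _ = ∏ i ∈ Finset.range e, (if i ∈ s then u else 1 - u) :=
          Finset.prod_congr rfl fun i _ => hprod i
      _ = _ := by
        rw [Finset.prod_ite, Finset.prod_const, Finset.prod_const,
          Finset.filter_mem_eq_inter, Finset.inter_eq_right.2 hs,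
          show (Finset.range e).filter (fun i => i ∉ s) = Finset.range e \ s from
            (Finset.sdiff_eq_filter _ _).symm, Finset.card_sdiff_of_subset hs, Finset.card_range]
  have hunion : D none ⁻¹' S none ∩
        {ω | k ≤ ((Finset.range e).filter fun i => D (some i) ω ∈ S (some i)).card}
      = ⋃ s ∈ (Finset.range e).powerset.filter (fun s => k ≤ s.card), C s := by
    ext ω
    simp only [hC, Set.mem_inter_iff, Set.mem_ofPred_eq, Set.mem_iUnion, Finset.mem_filter,
      Finset.mem_powerset, exists_prop]
    constructor
    · rintro ⟨h1, h2⟩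
      exact ⟨_, ⟨Finset.filter_subset _ _, h2⟩, h1, rfl⟩
    · rintro ⟨s, ⟨-, h2⟩, h1, rfl⟩
      exact ⟨h1, h2⟩
  rw [hunion, measureReal_biUnion_finset]
  · rw [Finset.sum_filter]
    set b : ℕ → ℝ := fun l => if k ≤ l then
      P.real (D none ⁻¹' S none) * (u ^ l * (1 - u) ^ (e - l)) else 0 with hb
    calc _ = ∑ s ∈ (Finset.range e).powerset, b s.card :=
          Finset.sum_congr rfl fun s hs => by
            simp only [hCval s hs, hb]
      _ = _ := by
        rw [Finset.sum_powerset_apply_card b, Finset.card_range, Finset.mul_sum]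
        simp only [hb]
        simp only [nsmul_eq_mul, mul_ite, mul_zero]
        rw [← Finset.sum_filter]
        refine Finset.sum_congr ?_ fun l _ => by ring
        ext l
        simp only [Finset.mem_filter, Finset.mem_range, Finset.mem_Icc]
        omega
  · intro s _ t _ hst
    refine Set.disjoint_left.2 fun ω h1 h2 => hst ?_
    exact h1.2.symm.trans h2.2
  · intro s hs
    exact hCmeas s (Finset.mem_filter.1 hs).1

end Binomial

/-! ### The threshold law and the recursion polynomial. -/

namespace ThresholdModel

theorem continuous_recursionPoly (V : ThresholdModel) : Continuous V.recursionPoly := by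
  unfold recursionPoly
  fun_prop

/-- The pairs `(d, k)` with `1 ≤ k ≤ d ≤ d₀`. -/
def pairs (V : ThresholdModel) : Finset (Σ _ : ℕ, ℕ) :=
  (Finset.Icc 1 V.d₀).sigma fun e => Finset.Icc 1 e

theorem sum_pairs (V : ThresholdModel) : ∑ x ∈ V.pairs, V.p x.1 * V.ζ x.2 x.1 = 1 := by
  rw [pairs, Finset.sum_sigma, ← V.p_sum]
  refine Finset.sum_congr rfl fun e he => ?_
  simp only
  rw [← Finset.mul_sum, V.ζ_sum e he, mul_one]

end ThresholdModel

namespace IsThresholdVoting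

variable {Ω : Type*} [MeasurableSpace Ω] {P : Measure Ω}
  {V : ThresholdModel} {q : ℝ → ℝ} {d L : List ℕ → Ω → ℕ} {X : List ℕ → Ω → ℝ}

theorem measurableSet_threshold (hM : IsThresholdVoting P V q d L X) (v : List ℕ) (e k : ℕ) :
    MeasurableSet {ω | d v ω = e ∧ L v ω = k} :=
  (hM.measurable_d v (measurableSet_singleton e)).inter
    (hM.measurable_L v (measurableSet_singleton k))

theorem measureReal_threshold (hM : IsThresholdVoting P V q d L X) (v : List ℕ)
    {x : Σ _ : ℕ, ℕ} (hx : x ∈ V.pairs) :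
    P.real {ω | d v ω = x.1 ∧ L v ω = x.2} = V.p x.1 * V.ζ x.2 x.1 := by
  rw [ThresholdModel.pairs, Finset.mem_sigma] at hx
  rw [measureReal_def, hM.law_threshold v x.1 hx.1 x.2 hx.2, ENNReal.toReal_ofReal]
  exact mul_nonneg (V.p_nonneg _ hx.1) (V.ζ_nonneg _ hx.1 _ hx.2)

/-- The prescribed probabilities of the admissible pairs already sum to one, so every other value of
`(d, L)` is null. -/
theorem ae_mem_pairs [IsProbabilityMeasure P] (hM : IsThresholdVoting P V q d L X) :
    ∀ᵐ ω ∂P, ∀ v, (⟨d v ω, L v ω⟩ : Σ _ : ℕ, ℕ) ∈ V.pairs := by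
  rw [ae_all_iff]
  intro v
  have hset : {ω | (⟨d v ω, L v ω⟩ : Σ _ : ℕ, ℕ) ∈ V.pairs}
      = ⋃ x ∈ V.pairs, {ω | d v ω = x.1 ∧ L v ω = x.2} := by
    ext ω
    simp only [Set.mem_ofPred_eq, Set.mem_iUnion, exists_prop]
    constructor
    · exact fun h => ⟨_, h, rfl, rfl⟩
    · rintro ⟨⟨e, k⟩, hx, h1, h2⟩
      simp only at h1 h2
      rwa [h1, h2]
  have hmeas : MeasurableSet {ω | (⟨d v ω, L v ω⟩ : Σ _ : ℕ, ℕ) ∈ V.pairs} := by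
    rw [hset]
    exact Finset.measurableSet_biUnion _ fun x _ => hM.measurableSet_threshold v x.1 x.2
  have hone : P.real {ω | (⟨d v ω, L v ω⟩ : Σ _ : ℕ, ℕ) ∈ V.pairs} = 1 := by
    rw [hset, measureReal_biUnion_finset _ fun x _ => hM.measurableSet_threshold v x.1 x.2,
      Finset.sum_congr rfl fun x hx => hM.measureReal_threshold v hx, V.sum_pairs]
    intro x _ y _ hxy
    refine Set.disjoint_left.2 fun ω h1 h2 => hxy ?_
    exact Sigma.ext (h1.1.symm.trans h2.1) (heq_of_eq (h1.2.symm.trans h2.2))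
  refine (mem_ae_iff_prob_eq_one hmeas).2 ?_
  rwa [measureReal_def, ENNReal.toReal_eq_one_iff] at hone

theorem ae_threshold [IsProbabilityMeasure P] (hM : IsThresholdVoting P V q d L X) :
    ∀ᵐ ω ∂P, (∀ v, 1 ≤ L v ω) ∧ ∀ v, L v ω ≤ d v ω := by
  filter_upwards [hM.ae_mem_pairs] with ω hω
  simp only [ThresholdModel.pairs, Finset.mem_sigma, Finset.mem_Icc] at hω
  exact ⟨fun v => (hω v).2.1, fun v => (hω v).2.2⟩

theorem exists_ae_abs_le (hM : IsThresholdVoting P V q d L X) (hq : IsJumpDensity q) :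
    ∃ R, 0 ≤ R ∧ ∀ᵐ ω ∂P, ∀ v, |X v ω| ≤ R := by
  obtain ⟨R, hR⟩ := hq.hasCompactSupport.isCompact.isBounded.subset_closedBall 0
  refine ⟨max R 0, le_max_right _ _, ?_⟩
  rw [ae_all_iff]
  intro v
  have h : ∀ᵐ x ∂(P.map (X v)), |x| ≤ max R 0 := by
    rw [hM.law_displacement v, ae_withDensity_iff (by have := hq.continuous; fun_prop)]
    refine Filter.Eventually.of_forall fun x hx => ?_
    have hx' : x ∈ tsupport q := subset_tsupport _ fun h0 => hx (by simp [h0])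
    have := hR hx'
    rw [mem_closedBall_zero_iff, Real.norm_eq_abs] at this
    exact this.trans (le_max_left _ _)
  exact ae_of_ae_map (hM.measurable_X v).aemeasurable h

theorem measurable_mark (hM : IsThresholdVoting P V q d L X) (v : List ℕ) :
    Measurable fun ω => ((d v ω, L v ω), X v ω) :=
  ((hM.measurable_d v).prodMk (hM.measurable_L v)).prodMk (hM.measurable_X v)

theorem map_threshold_eq [IsProbabilityMeasure P]
    (hM : IsThresholdVoting P V q d L X) (v w : List ℕ) :
    P.map (fun ω => (d v ω, L v ω)) = P.map fun ω => (d w ω, L w ω) := by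
  refine Measure.ext_of_singleton fun x => ?_
  have hpre : ∀ v, (fun ω => (d v ω, L v ω)) ⁻¹' {x} = {ω | d v ω = x.1 ∧ L v ω = x.2} := by
    intro v
    ext ω
    simp [Prod.ext_iff]
  rw [Measure.map_apply ((hM.measurable_d v).prodMk (hM.measurable_L v))
      (measurableSet_singleton x), Measure.map_apply
      ((hM.measurable_d w).prodMk (hM.measurable_L w)) (measurableSet_singleton x), hpre, hpre]
  by_cases hx : (⟨x.1, x.2⟩ : Σ _ : ℕ, ℕ) ∈ V.pairs
  · rw [ThresholdModel.pairs, Finset.mem_sigma] at hx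
    rw [hM.law_threshold v _ hx.1 _ hx.2, hM.law_threshold w _ hx.1 _ hx.2]
  · have hzero : ∀ v, P {ω | d v ω = x.1 ∧ L v ω = x.2} = 0 := by
      intro v
      refine measure_mono_null ?_ (ae_iff.1 hM.ae_mem_pairs)
      rintro ω ⟨h1, h2⟩ h
      have := h v
      rw [h1, h2] at this
      exact hx this
    rw [hzero, hzero]

theorem map_mark_eq [IsProbabilityMeasure P] (hM : IsThresholdVoting P V q d L X) (v w : List ℕ) :
    P.map (fun ω => ((d v ω, L v ω), X v ω)) = P.map fun ω => ((d w ω, L w ω), X w ω) := by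
  have h : ∀ v, P.map (fun ω => ((d v ω, L v ω), X v ω))
      = (P.map fun ω => (d v ω, L v ω)).prod (P.map (X v)) := fun v =>
    (indepFun_iff_map_prod_eq_prod_map_map
      ((hM.measurable_d v).prodMk (hM.measurable_L v)).aemeasurable
      (hM.measurable_X v).aemeasurable).1 (hM.indep_displacement v)
  rw [h v, h w, hM.map_threshold_eq v w, hM.law_displacement v, hM.law_displacement w]

theorem measurable_subtreeMarks [IsProbabilityMeasure P]
    (hM : IsThresholdVoting P V q d L X) (v : List ℕ) :
    Measurable (subtreeMarks d L X v) :=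
  measurable_pi_iff.2 fun w => hM.measurable_mark (w ++ v)

/-- Both laws are infinite products of one common mark law, since `u ↦ u ++ v` is injective. -/
theorem map_subtreeMarks_eq [IsProbabilityMeasure P]
    (hM : IsThresholdVoting P V q d L X) (v w : List ℕ) :
    P.map (subtreeMarks d L X v) = P.map (subtreeMarks d L X w) := by
  have h : ∀ v, P.map (subtreeMarks d L X v)
      = Measure.infinitePi fun u => P.map fun ω => ((d (u ++ v) ω, L (u ++ v) ω), X (u ++ v) ω) :=
    fun v => iIndepFun.map_fun_eq_infinitePi_map (fun u => hM.measurable_mark (u ++ v))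
      (hM.indep_vertices.precomp (g := fun u => u ++ v) (List.append_left_injective v))
  rw [h v, h w]
  congr 1
  ext1 u
  exact hM.map_mark_eq _ _

theorem measurable_voteOutcome (hM : IsThresholdVoting P V q d L X) (n : ℕ) :
    Measurable (voteOutcome d L X n) :=
  measurable_voteValue hM.measurable_d hM.measurable_L hM.measurable_X n []

theorem measureReal_markOutcome_le [IsProbabilityMeasure P]
    (hM : IsThresholdVoting P V q d L X) (n : ℕ) (v : List ℕ)
    (y : ℝ) : P.real {ω | markOutcome n (subtreeMarks d L X v ω) ≤ y}
      = (P.map (voteOutcome d L X n)).real (Set.Iic y) := by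
  have h1 : P.map (voteOutcome d L X n)
      = (P.map (subtreeMarks d L X [])).map (markOutcome n) := by
    rw [Measure.map_map (measurable_markOutcome n) (hM.measurable_subtreeMarks [])]
    refine Measure.map_congr ?_
    filter_upwards [hM.ae_threshold] with ω hω
    have := voteValue_eq_add_markOutcome (X := X) hω.1 hω.2 n []
    rwa [brwPosition, zero_add] at this
  rw [h1, hM.map_subtreeMarks_eq [] v,
    Measure.map_map (measurable_markOutcome n) (hM.measurable_subtreeMarks v),
    map_measureReal_apply ((measurable_markOutcome n).comp (hM.measurable_subtreeMarks v))
      measurableSet_Iic]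
  rfl

/-- The probability that at least `L` of the `d` subtrees at the root have a relative outcome at
most `y` is the recursion polynomial at the distribution function of the outcome. -/
theorem measureReal_threshold_le_card [IsProbabilityMeasure P]
    (hM : IsThresholdVoting P V q d L X) (n : ℕ) (y : ℝ) :
    P.real {ω | L [] ω ≤ ((Finset.range (d [] ω)).filter fun i =>
        markOutcome n (subtreeMarks d L X [i] ω) ≤ y).card}
      = V.recursionPoly ((P.map (voteOutcome d L X n)).real (Set.Iic y)) := by
  classical
  set u := (P.map (voteOutcome d L X n)).real (Set.Iic y) with hu
  set A : Set Ω := {ω | L [] ω ≤ ((Finset.range (d [] ω)).filter fun i =>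
        markOutcome n (subtreeMarks d L X [i] ω) ≤ y).card} with hA
  set B : (Σ _ : ℕ, ℕ) → Set Ω := fun x => {ω | d [] ω = x.1 ∧ L [] ω = x.2} ∩
    {ω | x.2 ≤ ((Finset.range x.1).filter fun i =>
        markOutcome n (subtreeMarks d L X [i] ω) ≤ y).card} with hB
  have hBmeas : ∀ x, MeasurableSet (B x) := fun x =>
    (hM.measurableSet_threshold [] x.1 x.2).inter
      (measurableSet_le_card_filter x.2 x.1
        (fun i => (measurable_markOutcome n).comp (hM.measurable_subtreeMarks [i])) y)
  have hAB : A =ᵐ[P] ⋃ x ∈ V.pairs, B x := by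
    filter_upwards [hM.ae_mem_pairs] with ω hω
    refine propext ?_
    change ω ∈ A ↔ ω ∈ ⋃ x ∈ V.pairs, B x
    simp only [hA, hB, Set.mem_iUnion, Set.mem_inter_iff, Set.mem_ofPred_eq, exists_prop]
    constructor
    · exact fun h => ⟨_, hω [], ⟨rfl, rfl⟩, h⟩
    · rintro ⟨x, -, ⟨h1, h2⟩, h⟩
      rwa [h1, h2]
  have hBval : ∀ x ∈ V.pairs, P.real (B x) = V.p x.1 * V.ζ x.2 x.1 *
      ∑ l ∈ Finset.Icc x.2 x.1, (x.1.choose l : ℝ) * u ^ l * (1 - u) ^ (x.1 - l) := by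
    intro x hx
    -- Labels grow at the head, so the last entry names the child of the root from which a vertex
    -- descends, and `none` singles out the root. The fibers are thus the root and the subtrees of
    -- its children.
    have hind := hM.indep_vertices.fibers hM.measurable_mark List.getLast?
    have hlast : ∀ (i : ℕ) (w : List ℕ), (w ++ [i]).getLast? = some i := fun i w => by simp
    have := measureReal_inter_le_card_filter (P := P)
      (D := fun (o : Option ℕ) ω (v : {v : List ℕ // v.getLast? = o}) =>
        ((d v ω, L v ω), X v ω))
      (fun o => measurable_pi_iff.2 fun v => hM.measurable_mark v) hind
      (S := Option.rec (motive := fun o => Set ({v : List ℕ // v.getLast? = o} → Mark))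
        {z | (z ⟨[], rfl⟩).1.1 = x.1 ∧ (z ⟨[], rfl⟩).1.2 = x.2}
        fun i => {z | markOutcome n (fun w => z ⟨w ++ [i], hlast i w⟩) ≤ y})
      (u := u) ?_ ?_ (hdec := fun i ω => Real.decidableLE _ _) x.2 x.1
    · rw [← hM.measureReal_threshold [] hx]
      exact this
    · intro o
      cases o with
      | none =>
        refine (measurableSet_eq_fun ?_ measurable_const).inter
          (measurableSet_eq_fun ?_ measurable_const) <;> fun_prop
      | some i =>
        refine measurableSet_le ((measurable_markOutcome n).comp ?_) measurable_const
        fun_prop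
    · exact fun i => hM.measureReal_markOutcome_le n [i] y
  rw [measureReal_congr hAB, measureReal_biUnion_finset _ fun x _ => hBmeas x,
    Finset.sum_congr rfl hBval, ThresholdModel.pairs, Finset.sum_sigma]
  · rfl
  · intro x _ y _ hxy
    refine Set.disjoint_left.2 fun ω h1 h2 => hxy ?_
    exact Sigma.ext (h1.1.1.symm.trans h2.1.1) (heq_of_eq (h1.1.2.symm.trans h2.1.2))

end IsThresholdVoting

/-! ### One-step bounds, absence of atoms, and the uniform climb. -/

namespace IsThresholdVoting

variable {Ω : Type*} [MeasurableSpace Ω] {P : Measure Ω}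
  {V : ThresholdModel} {q : ℝ → ℝ} {d L : List ℕ → Ω → ℕ} {X : List ℕ → Ω → ℝ}

/-- One step of the voting recursion, up to shifts by the range `R` of the displacements. -/
theorem recursionPoly_bounds [IsProbabilityMeasure P] (hM : IsThresholdVoting P V q d L X) {R : ℝ}
    (hR : ∀ᵐ ω ∂P, ∀ v, |X v ω| ≤ R) (n : ℕ) (x : ℝ) :
    V.recursionPoly ((P.map (voteOutcome d L X n)).real (Set.Iic (x - R)))
        ≤ (P.map (voteOutcome d L X (n + 1))).real (Set.Iic x) ∧
      (P.map (voteOutcome d L X (n + 1))).real (Set.Iic x)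
        ≤ V.recursionPoly ((P.map (voteOutcome d L X n)).real (Set.Iic (x + R))) := by
  rw [← hM.measureReal_threshold_le_card, ← hM.measureReal_threshold_le_card,
    map_measureReal_apply (hM.measurable_voteOutcome (n + 1)) measurableSet_Iic]
  have key : ∀ᵐ ω ∂P, (voteOutcome d L X (n + 1) ω ≤ x ↔ L [] ω ≤
      ((Finset.range (d [] ω)).filter fun i =>
        X [i] ω + markOutcome n (subtreeMarks d L X [i] ω) ≤ x).card) := by
    filter_upwards [hM.ae_threshold] with ω hω
    rw [voteOutcome, voteValue, orderStat_le_iff (hω.1 []) (hω.2 [])]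
    simp only [voteValue_eq_add_markOutcome (X := X) hω.1 hω.2 n, brwPosition, zero_add]
  constructor
  · refine ENNReal.toReal_mono (measure_ne_top _ _) (measure_mono_ae ?_)
    filter_upwards [key, hR] with ω hω hRω hmem
    refine hω.2 (hmem.trans (Finset.card_le_card fun i hi => ?_))
    rw [Finset.mem_filter] at hi ⊢
    exact ⟨hi.1, by linarith [hi.2, (abs_le.1 (hRω [i])).2]⟩
  · refine ENNReal.toReal_mono (measure_ne_top _ _) (measure_mono_ae ?_)
    filter_upwards [key, hR] with ω hω hRω hmem
    refine (hω.1 hmem).trans (Finset.card_le_card fun i hi => ?_)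
    rw [Finset.mem_filter] at hi ⊢
    exact ⟨hi.1, by linarith [hi.2, (abs_le.1 (hRω [i])).1]⟩

theorem shift_bounds [IsProbabilityMeasure P] (hM : IsThresholdVoting P V q d L X) {R : ℝ}
    (hR : ∀ᵐ ω ∂P, ∀ v, |X v ω| ≤ R) (n : ℕ) (x : ℝ) :
    (P.map (voteOutcome d L X n)).real (Set.Iic (x - R))
        ≤ (P.map (voteOutcome d L X (n + 1))).real (Set.Iic x) ∧
      (P.map (voteOutcome d L X (n + 1))).real (Set.Iic x)
        ≤ (P.map (voteOutcome d L X n)).real (Set.Iic (x + R)) := by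
  simp only [map_measureReal_apply (hM.measurable_voteOutcome _) measurableSet_Iic]
  constructor
  · refine ENNReal.toReal_mono (measure_ne_top _ _) (measure_mono_ae ?_)
    filter_upwards [hM.ae_threshold, hR] with ω hω hRω
      (hmem : voteValue d L X n [] ω ≤ x - R)
    have := (abs_sub_le_iff.1 (abs_voteValue_succ_sub_le hω.1 hω.2 hRω n [])).1
    change voteValue d L X (n + 1) [] ω ≤ x
    linarith
  · refine ENNReal.toReal_mono (measure_ne_top _ _) (measure_mono_ae ?_)
    filter_upwards [hM.ae_threshold, hR] with ω hω hRω
      (hmem : voteValue d L X (n + 1) [] ω ≤ x)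
    have := (abs_sub_le_iff.1 (abs_voteValue_succ_sub_le hω.1 hω.2 hRω n [])).2
    change voteValue d L X n [] ω ≤ x + R
    linarith

/-- The position of `v` uses only displacements with labels of length at most that of `v`, and `i ::
v` is longer. -/
theorem indepFun_brwPosition [IsProbabilityMeasure P]
    (hM : IsThresholdVoting P V q d L X) (i : ℕ) (v : List ℕ) :
    IndepFun (brwPosition X v) (X (i :: v)) P := by
  have hX : iIndepFun X P :=
    hM.indep_vertices.comp (fun _ (z : Mark) => z.2) fun _ => measurable_snd
  have hdisj : Disjoint {w : List ℕ | w.length ≤ v.length} {i :: v} := by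
    simp
  have h := indep_iSup_of_disjoint (fun w => (hM.measurable_X w).comap_le) hX.iIndep hdisj
  refine indep_of_indep_of_le h ?_ ?_
  · rw [← measurable_iff_comap_le]
    refine @measurable_brwPosition _
      (⨆ w ∈ {w : List ℕ | w.length ≤ v.length}, MeasurableSpace.comap (X w) inferInstance)
      X v fun w hw => ?_
    rw [measurable_iff_comap_le]
    exact le_iSup₂_of_le w hw le_rfl
  · exact le_iSup₂_of_le (i :: v) rfl le_rfl

/-- The last displacement has a density and is independent of the parent's position, so by Fubini
the sum has no atoms. -/
theorem measure_brwPosition_cons_eq [IsProbabilityMeasure P]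
    (hM : IsThresholdVoting P V q d L X) (i : ℕ) (v : List ℕ)
    (x : ℝ) : P {ω | brwPosition X (i :: v) ω = x} = 0 := by
  have hpos : Measurable (brwPosition X v) :=
    measurable_brwPosition v fun w _ => hM.measurable_X w
  have hset : MeasurableSet {y : ℝ × ℝ | y.1 + y.2 = x} :=
    measurableSet_eq_fun (measurable_fst.add measurable_snd) measurable_const
  have h : P {ω | brwPosition X (i :: v) ω = x}
      = (P.map fun ω => (brwPosition X v ω, X (i :: v) ω)) {y | y.1 + y.2 = x} := by
    rw [Measure.map_apply (hpos.prodMk (hM.measurable_X _)) hset]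
    rfl
  have : IsProbabilityMeasure (P.map (X (i :: v))) :=
    Measure.isProbabilityMeasure_map (hM.measurable_X _).aemeasurable
  rw [h, (indepFun_iff_map_prod_eq_prod_map_map hpos.aemeasurable
    (hM.measurable_X _).aemeasurable).1 (hM.indepFun_brwPosition i v),
    Measure.measure_prod_null hset]
  refine Filter.Eventually.of_forall fun a => ?_
  have hsub : (Prod.mk a ⁻¹' {y : ℝ × ℝ | y.1 + y.2 = x}) = {x - a} := by
    ext b
    simp only [Set.mem_preimage, Set.mem_ofPred_eq, Set.mem_singleton_iff]
    constructor <;> intro h <;> linarith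
  change P.map (X (i :: v)) (Prod.mk a ⁻¹' {y : ℝ × ℝ | y.1 + y.2 = x}) = 0
  rw [hsub, hM.law_displacement]
  exact withDensity_absolutelyContinuous _ _ (measure_singleton _)

/-- The outcome is almost surely the position of some non-root vertex, and there are countably many
labels. At `n = 0` the law is a point mass, hence the index `n + 1`. -/
theorem nullSingletonClass_map_voteOutcome [IsProbabilityMeasure P]
    (hM : IsThresholdVoting P V q d L X) (n : ℕ) :
    NullSingletonClass (P.map (voteOutcome d L X (n + 1))) := by
  refine ⟨fun x => ?_⟩
  rw [Measure.map_apply (hM.measurable_voteOutcome _) (measurableSet_singleton x)]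
  have hnull : P (⋃ p : ℕ × List ℕ, {ω | brwPosition X (p.1 :: p.2) ω = x}) = 0 :=
    measure_iUnion_null fun p => hM.measure_brwPosition_cons_eq p.1 p.2 x
  refine measure_mono_null_ae ?_ hnull
  filter_upwards [hM.ae_threshold] with ω hω hmem
  obtain ⟨u, hu, huω⟩ := exists_voteValue_eq_brwPosition (X := X) hω.1 hω.2 (n + 1) []
  rw [List.append_nil] at huω
  obtain ⟨i, w, rfl⟩ := List.exists_cons_of_length_eq_add_one hu
  exact Set.mem_iUnion.2 ⟨(i, w), huω.symm.trans hmem⟩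

/-- Between two levels enclosing no zero of the nonlinearity, the distribution functions of all
the outcomes climb within a common distance. -/
theorem exists_climb [IsProbabilityMeasure P]
    (hM : IsThresholdVoting P V q d L X) (hq : IsJumpDensity q) {a b : ℝ}
    (hab : a ≤ b) (hne : ∀ u ∈ Set.Icc a b, V.nonlinearity u ≠ 0) :
    ∃ K, 0 ≤ K ∧ ∀ n x, a < (P.map (voteOutcome d L X n)).real (Set.Iic x) →
      b ≤ (P.map (voteOutcome d L X n)).real (Set.Iic (x + K)) := by
  obtain ⟨R, hR0, hR⟩ := hM.exists_ae_abs_le hq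
  -- One shift by `R` comes from the recursion, the other from returning from `n + 1` to `n`.
  obtain ⟨K, hK0, hK⟩ := exists_climb_of_fixedPointFree V.continuous_recursionPoly hab
    (r := 2 * R) (by linarith) hne
  refine ⟨K, hK0, fun n => ?_⟩
  have : IsProbabilityMeasure (P.map (voteOutcome d L X n)) :=
    Measure.isProbabilityMeasure_map (hM.measurable_voteOutcome n).aemeasurable
  refine hK (fun x => (P.map (voteOutcome d L X n)).real (Set.Iic x))
    (fun x y hxy => measureReal_mono (Set.Iic_subset_Iic.2 hxy)) (fun x => ?_) fun x => ?_
  · have h1 := (hM.recursionPoly_bounds hR n (x + R)).1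
    have h2 := (hM.shift_bounds hR n (x + R)).2
    rw [add_sub_cancel_right] at h1
    rw [add_assoc, ← two_mul] at h2
    exact h1.trans h2
  · have h1 := (hM.recursionPoly_bounds hR n (x - R)).2
    have h2 := (hM.shift_bounds hR n (x - R)).1
    rw [sub_add_cancel] at h1
    rw [sub_sub, ← two_mul] at h2
    exact h2.trans h1

end IsThresholdVoting

/-! ### Tightness and the main theorem. -/

theorem isTightMeasureSet_range_of_succ {μ : ℕ → Measure ℝ} [IsFiniteMeasure (μ 0)]
    (h : ∀ ε : ℝ, 0 < ε → ∃ K : ℝ, ∀ n, μ (n + 1) (Set.Icc (-K) K)ᶜ ≤ ENNReal.ofReal ε) :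
    IsTightMeasureSet (Set.range μ) := by
  have hsucc : IsTightMeasureSet (Set.range fun n => μ (n + 1)) := by
    rw [isTightMeasureSet_iff_exists_isCompact_measure_compl_le]
    intro ε hε
    rcases eq_or_ne ε ⊤ with rfl | hε'
    · exact ⟨∅, isCompact_empty, fun _ _ => le_top⟩
    obtain ⟨K, hK⟩ := h ε.toReal (ENNReal.toReal_pos hε.ne' hε')
    refine ⟨Set.Icc (-K) K, isCompact_Icc, ?_⟩
    rintro _ ⟨n, rfl⟩
    simpa [ENNReal.ofReal_toReal hε'] using hK n
  refine (hsucc.union (isTightMeasureSet_singleton (μ := μ 0))).subset ?_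
  rintro _ ⟨n, rfl⟩
  cases n with
  | zero => exact Or.inr rfl
  | succ n => exact Or.inl ⟨n, rfl⟩

theorem theorem3p1
    {Ω : Type*} [MeasurableSpace Ω] (P : Measure Ω) [IsProbabilityMeasure P]
    (V : ThresholdModel) (q : ℝ → ℝ) (hq : IsJumpDensity q)
    (d L : List ℕ → Ω → ℕ) (X : List ℕ → Ω → ℝ) (hM : IsThresholdVoting P V q d L X)
    (hf : V.nonlinearity ≠ 0)
    (α : Fin (V.numZeros + 2) → ℝ) (hα : StrictMono α)
    (hzeros : Set.range α = {u : ℝ | u ∈ Set.Icc (0 : ℝ) 1 ∧ V.nonlinearity u = 0})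
    (Q : Fin (V.numZeros + 2) → ℕ → EReal)
    (hQ : ∀ s n, IsQuantile (P.map (voteOutcome d L X n)) (α s) (Q s n))
    (s : Fin (V.numZeros + 1)) :
    (∀ n, P {ω | voteOutcome d L X n ω ∈ realIcc (Q s.castSucc n) (Q s.succ n)} ≠ 0) ∧
    ∀ m : ℕ → ℝ,
      (∀ n, IsQuantile ((P.map (voteOutcome d L X n))[|realIcc (Q s.castSucc n) (Q s.succ n)])
        (1 / 2) (m n : EReal)) →
      IsTightMeasureSet (Set.range fun n =>
        ((P.map (voteOutcome d L X n))[|realIcc (Q s.castSucc n) (Q s.succ n)]).map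
          fun x => x - m n) := by
  have hprob : ∀ n, IsProbabilityMeasure (P.map (voteOutcome d L X n)) := fun n =>
    Measure.isProbabilityMeasure_map (hM.measurable_voteOutcome n).aemeasurable
  have hlt : α s.castSucc < α s.succ := hα s.castSucc_lt_succ
  have hmem : ∀ j, α j ∈ Set.Icc (0 : ℝ) 1 := fun j => by
    have : α j ∈ Set.range α := ⟨j, rfl⟩
    rw [hzeros] at this
    exact this.1
  have h0 : 0 ≤ α s.castSucc := (hmem _).1
  have hne : ∀ u ∈ Set.Ioo (α s.castSucc) (α s.succ), V.nonlinearity u ≠ 0 := by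
    intro u hu hu0
    have : u ∈ Set.range α := by
      rw [hzeros]
      exact ⟨⟨h0.trans hu.1.le, hu.2.le.trans (hmem _).2⟩, hu0⟩
    obtain ⟨j, rfl⟩ := this
    have h1 := hα.lt_iff_lt.1 hu.1
    have h2 := hα.lt_iff_lt.1 hu.2
    rw [Fin.lt_def] at h1 h2
    simp at h1 h2
    omega
  have hpos : ∀ n, P.map (voteOutcome d L X n) (realIcc (Q s.castSucc n) (Q s.succ n)) ≠ 0 := by
    intro n hzero
    have h1 := (hQ s.castSucc n).sub_le_real_realIcc h0 (hQ s.succ n)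
    rw [measureReal_def, hzero, ENNReal.toReal_zero] at h1
    linarith
  refine ⟨fun n => ?_, fun m hm => ?_⟩
  · have := hpos n
    rwa [Measure.map_apply (hM.measurable_voteOutcome n) (measurableSet_realIcc _ _)] at this
  have hcprob : ∀ n, IsProbabilityMeasure
      ((P.map (voteOutcome d L X n))[|realIcc (Q s.castSucc n) (Q s.succ n)]) :=
    fun n => cond_isProbabilityMeasure (hpos n)
  refine isTightMeasureSet_range_of_succ fun ε hε => ?_
  set δ := α s.succ - α s.castSucc with hδ
  have hδ0 : 0 < δ := sub_pos.2 hlt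
  -- The first term makes the escaping mass `2 * η / δ` at most `ε`; the second keeps `α s.castSucc
  -- + η ≤ α s.succ - η` and `2 * η < δ`.
  set η := min (ε * δ / 2) (δ / 3) with hη
  have hη0 : 0 < η := by positivity
  have hη1 : η ≤ ε * δ / 2 := min_le_left _ _
  have hη2 : η ≤ δ / 3 := min_le_right _ _
  obtain ⟨K, hK0, hK⟩ := hM.exists_climb hq (a := α s.castSucc + η) (b := α s.succ - η)
    (by linarith) fun u hu => hne u ⟨by linarith [hu.1], by linarith [hu.2]⟩
  refine ⟨K + 1, fun n => ?_⟩
  have := hM.nullSingletonClass_map_voteOutcome n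
  have hbound := cond_realIcc_compl_Icc_le h0 hlt (hQ s.castSucc (n + 1)) (hQ s.succ (n + 1))
    hη0.le (by linarith) (hK (n + 1)) (hm (n + 1)) (lt_add_one K)
  have hε' : 2 * η / δ ≤ ε := by
    rw [div_le_iff₀ hδ0]
    linarith
  rw [Measure.map_apply (by fun_prop) measurableSet_Icc.compl]
  have hpre : (fun x => x - m (n + 1)) ⁻¹' (Set.Icc (-(K + 1)) (K + 1))ᶜ
      = (Set.Icc (m (n + 1) - (K + 1)) (m (n + 1) + (K + 1)))ᶜ := by
    ext x
    simp only [Set.mem_preimage, Set.mem_compl_iff, Set.mem_Icc, neg_le_sub_iff_le_add,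
      tsub_le_iff_right, not_iff_not]
    constructor <;> rintro ⟨h1, h2⟩ <;> constructor <;> linarith
  rw [hpre, ENNReal.le_ofReal_iff_toReal_le (measure_ne_top _ _) hε.le]
  exact hbound.trans hε'
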